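/- Let $\mathcal N$ be the linear map on operators on $\mathbb C^3$ given by $\mathcal N(\rho)=\tfrac12(\operatorname{tr}\rho)\mathbb 1-\tfrac12\rho^{\mathrm T}$ (transpose in the computational basis). Let $J(\mathcal N)=\sum_{i,j}|i\rangle\langle j|\otimes\mathcal N(|i\rangle\langle j|)$ be its Choi operator. Then $\mathcal N$ is completely positive and trace preserving, it is unital ($\mathcal N(\mathbb 1)=\mathbb 1$), and it is not a mixed-unitary channel, i.e. not of the form $\rho\mapsto\sum_m p(m)U_m\rho U_m^\dagger$ with $p$ a probability distribution and $U_m$ unitary. Moreover, there is a three-qutrit pure state $|\psi\rangle^{RAB}\in(\mathbb C^3)^{\otimes 3}$ with the following properties, where $\psi^R$, $\psi^B$, $\psi^{AB}$, $\psi^{RB}$ denote its reduced states. 1. $\psi^R=\mathbb 1^R/3$ and $\psi^{RB}=J(\mathcal N)/3$. 2. $\min\left\{\log_2 K : K\in\{1,2,\dots\},\ \tfrac{\mathbb 1_K}{K}\otimes\psi^B\prec\psi^{AB}\right\}=0$, where $\prec$ denotes majorization of spectra (the shorter list of eigenvalues being padded by zeros). 3. Non-catalytic exact state merging of $|\psi\rangle^{RAB}$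 cannot be achieved by one-way LOCC from $A$ to $B$ at entanglement cost $\log_2K$ equal to this minimum. That is, for no integer $K\ge1$ with $\log_2K=0$ is there a one-way LOCC map $\mathcal M$ from $A$ to $B$ with $$\left(\mathrm{id}^R\otimes\mathcal M\right)\left(\psi^{RAB}\otimes\Phi_K^{+\,\overline A\,\overline B}\right)=\psi^{RB'B}.$$ Here $B'$, of the same dimension as $A$, is held by $B$, and $|\Phi_K^+\rangle=K^{-1/2}\sum_{l=0}^{K-1}|l\rangle\otimes|l\rangle$ is shared by $A$ (holding $\overline A$) and $B$ (holding $\overline B$). A one-way LOCC map from $A$ to $B$ is a map $\sum_i\mathcal E_i\otimes\mathcal F_i$, where $(\mathcal E_i)_i$ is a quantum instrument of $A$ with finitely or countably many outcomes and each $\mathcal F_i$ is a completely positive trace-preserving map of $B$. -/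

import Mathlib

open scoped Matrix Kronecker ComplexOrder

noncomputable section

namespace ExactMerging

/-! ### Operators and linear maps between operator spaces -/

/-- Operators on the Hilbert space with computational basis indexed by `n`. -/
abbrev Op (n : Type*) : Type _ := Matrix n n ℂ

/-- The tensor product `Φ ⊗ Ψ` of two linear maps of operators: the linear map with
`(Φ ⊗ Ψ)(X ⊗ Y) = Φ X ⊗ Ψ Y`, see `tensorMap_kronecker`. -/
def tensorMap {m n m' n' : Type*} [Fintype m] [DecidableEq m] [Fintype m'] [DecidableEq m']
    (Φ : Op m →ₗ[ℂ] Op n) (Ψ : Op m' →ₗ[ℂ] Op n') : Op (m × m') →ₗ[ℂ] Op (n × n') where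
  toFun X := ∑ k : m × m', ∑ l : m × m',
    X k l • (Φ (Matrix.single k.1 l.1 1) ⊗ₖ Ψ (Matrix.single k.2 l.2 1))
  map_add' X Y := by
    simp only [Matrix.add_apply, add_smul, Finset.sum_add_distrib]
  map_smul' c X := by
    simp only [Matrix.smul_apply, smul_eq_mul, mul_smul, Finset.smul_sum, RingHom.id_apply]

theorem tensorMap_kronecker {m n m' n' : Type*} [Fintype m] [DecidableEq m]
    [Fintype m'] [DecidableEq m'] (Φ : Op m →ₗ[ℂ] Op n) (Ψ : Op m' →ₗ[ℂ] Op n')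
    (X : Op m) (Y : Op m') : tensorMap Φ Ψ (X ⊗ₖ Y) = Φ X ⊗ₖ Ψ Y := by
  have hX : Φ X = ∑ i, ∑ j, X i j • Φ (Matrix.single i j 1) := by
    conv_lhs => rw [Matrix.matrix_eq_sum_single X]
    simp only [map_sum, ← LinearMap.map_smul, Matrix.smul_single, smul_eq_mul, mul_one]
  have hY : Ψ Y = ∑ i, ∑ j, Y i j • Ψ (Matrix.single i j 1) := by
    conv_lhs => rw [Matrix.matrix_eq_sum_single Y]
    simp only [map_sum, ← LinearMap.map_smul, Matrix.smul_single, smul_eq_mul, mul_one]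
  ext a b
  rw [Matrix.kroneckerMap_apply, hX, hY]
  simp only [tensorMap, LinearMap.coe_mk, AddHom.coe_mk, Fintype.sum_prod_type, Matrix.sum_apply,
    Matrix.smul_apply, Matrix.kroneckerMap_apply, smul_eq_mul, Finset.sum_mul_sum]
  refine Finset.sum_congr rfl fun i _ => Finset.sum_congr rfl fun j _ => ?_
  refine Finset.sum_congr rfl fun k _ => Finset.sum_congr rfl fun l _ => ?_
  ring

/-- Complete positivity: `id_k ⊗ Φ` preserves positive semidefiniteness for every `k`. -/
def IsCP {m n : Type*} [Fintype m] [DecidableEq m] (Φ : Op m →ₗ[ℂ] Op n) : Prop :=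
  ∀ (k : ℕ) (X : Op (Fin k × m)), X.PosSemidef →
    (tensorMap (LinearMap.id : Op (Fin k) →ₗ[ℂ] Op (Fin k)) Φ X).PosSemidef

/-- A quantum channel: a completely positive and trace-preserving (CPTP) map. -/
def IsChannel {m n : Type*} [Fintype m] [DecidableEq m] [Fintype n]
    (Φ : Op m →ₗ[ℂ] Op n) : Prop :=
  IsCP Φ ∧ ∀ X, (Φ X).trace = X.trace

/-- A quantum instrument: a family of completely positive maps, indexed by the measurement
outcomes, whose sum is trace preserving. -/
def IsInstrument {ι m n : Type*} [Fintype m] [DecidableEq m] [Fintype n]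
    (E : ι → (Op m →ₗ[ℂ] Op n)) : Prop :=
  (∀ i, IsCP (E i)) ∧ ∀ X, HasSum (fun i => (E i X).trace) X.trace

/-- A mixed-unitary channel `ρ ↦ ∑ₘ p(m) Uₘ ρ Uₘ†`, with `p` a probability distribution. -/
def IsMixedUnitary {n : Type*} [Fintype n] [DecidableEq n] (Φ : Op n →ₗ[ℂ] Op n) : Prop :=
  ∃ (N : ℕ) (p : Fin N → ℝ) (U : Fin N → Matrix.unitaryGroup n ℂ),
    (∀ m, 0 ≤ p m) ∧ ∑ m, p m = 1 ∧
    ∀ ρ, Φ ρ = ∑ m, (p m : ℂ) • ((U m : Op n) * ρ * (U m : Op n)ᴴ)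

/-- The Choi operator `J(Φ) = ∑ᵢⱼ |i⟩⟨j| ⊗ Φ(|i⟩⟨j|)`; the reference system is the first factor. -/
def choi {m n : Type*} [Fintype m] [DecidableEq m] (Φ : Op m →ₗ[ℂ] Op n) : Op (m × n) :=
  ∑ i, ∑ j, Matrix.single i j 1 ⊗ₖ Φ (Matrix.single i j 1)

/-- The channel `𝒩(ρ) = ½ (tr ρ) 𝟙 - ½ ρᵀ` on a qutrit. -/
def wernerHolevo : Op (Fin 3) →ₗ[ℂ] Op (Fin 3) where
  toFun ρ := (1 / 2 : ℂ) • (ρ.trace • (1 : Op (Fin 3))) - (1 / 2 : ℂ) • ρᵀ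
  map_add' X Y := by
    simp only [Matrix.trace_add, add_smul, smul_add, Matrix.transpose_add]
    abel
  map_smul' c X := by
    simp only [Matrix.trace_smul, smul_eq_mul, mul_smul, Matrix.transpose_smul, RingHom.id_apply,
      smul_sub, smul_comm c]

/-! ### One-way LOCC -/

/-- `M`, taking operators of `A ⊗ B` to operators of `A' ⊗ B'`, is a one-way LOCC map from `A` to
`B`: `A` performs an instrument `E`, with finitely or countably many outcomes, and sends the outcome
`i` to `B`, who then performs the channel `F i`; that is, `M = ∑ᵢ E i ⊗ F i`. -/
def IsOneWayLOCC {a b a' b' : Type*} [Fintype a] [DecidableEq a] [Fintype b] [DecidableEq b]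
    [Fintype a'] [Fintype b'] (M : Op (a × b) →ₗ[ℂ] Op (a' × b')) : Prop :=
  ∃ (ι : Type) (_ : Countable ι) (E : ι → (Op a →ₗ[ℂ] Op a')) (F : ι → (Op b →ₗ[ℂ] Op b')),
    IsInstrument E ∧ (∀ i, IsChannel (F i)) ∧
    ∀ X, HasSum (fun i => tensorMap (E i) (F i) X) (M X)

/-! ### States -/

/-- The operator `|v⟩⟨v|`. -/
def proj {n : Type*} (v : n → ℂ) : Op n := Matrix.vecMulVec v (star v)

/-- The partial trace over the first factor. -/
def traceFst {m n : Type*} [Fintype m] (X : Op (m × n)) : Op n :=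
  Matrix.of fun i j => ∑ k, X (k, i) (k, j)

/-- The partial trace over the second factor. -/
def traceSnd {m n : Type*} [Fintype n] (X : Op (m × n)) : Op m :=
  Matrix.of fun i j => ∑ k, X (i, k) (j, k)

variable {R A B : Type*} [Fintype R] [Fintype A] [Fintype B]

/-- The reduced state `ψ^R` of the pure state `ψ` on `R ⊗ A ⊗ B`. -/
def stateR (ψ : EuclideanSpace ℂ (R × A × B)) : Op R := traceSnd (proj ψ)

/-- The reduced state `ψ^AB`. -/
def stateAB (ψ : EuclideanSpace ℂ (R × A × B)) : Op (A × B) := traceFst (proj ψ)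

/-- The reduced state `ψ^B`. -/
def stateB (ψ : EuclideanSpace ℂ (R × A × B)) : Op B := traceFst (stateAB ψ)

/-- The reduced state `ψ^RB`. -/
def stateRB (ψ : EuclideanSpace ℂ (R × A × B)) : Op (R × B) :=
  Matrix.of fun i j => ∑ k, proj ψ (i.1, k, i.2) (j.1, k, j.2)

/-- The maximally entangled vector `|Φ⁺_K⟩ = K^{-1/2} ∑ₗ |l⟩ ⊗ |l⟩` of Schmidt rank `K`. -/
def maxEnt (K : ℕ) : Fin K × Fin K → ℂ :=
  fun l => if l.1 = l.2 then ((Real.sqrt K)⁻¹ : ℝ) else 0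

/-! ### Exact state merging -/

/-- The initial vector `|ψ⟩^{RAB} ⊗ |Φ⁺_K⟩`, the systems being grouped as `R`, those of party `A`
(`A` and its share of the resource), those of party `B` (`B` and its share of the resource). -/
def initialVec (ψ : EuclideanSpace ℂ (R × A × B)) (K : ℕ) : R × (A × Fin K) × (B × Fin K) → ℂ :=
  fun x => ψ (x.1, x.2.1.1, x.2.2.1) * maxEnt K (x.2.1.2, x.2.2.2)

/-- The final vector `|ψ⟩^{RB'B} ⊗ |Φ⁺_L⟩`, where `B'`, a copy of `A`, is held by party `B`. -/
def finalVec (ψ : EuclideanSpace ℂ (R × A × B)) (L : ℕ) :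
    R × Fin L × ((A × B) × Fin L) → ℂ :=
  fun x => ψ (x.1, x.2.2.1.1, x.2.2.1.2) * maxEnt L (x.2.1, x.2.2.2)

/-- `M` achieves exact state merging of `ψ` with initial and final resource states of Schmidt rank
`K` and `L`: `(id^R ⊗ M)(ψ^{RAB} ⊗ Φ⁺_K) = ψ^{RB'B} ⊗ Φ⁺_L`. -/
def AchievesMerging [DecidableEq R] [DecidableEq A] [DecidableEq B]
    (ψ : EuclideanSpace ℂ (R × A × B)) (K L : ℕ)
    (M : Op ((A × Fin K) × (B × Fin K)) →ₗ[ℂ] Op (Fin L × ((A × B) × Fin L))) : Prop :=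
  tensorMap (LinearMap.id : Op R →ₗ[ℂ] Op R) M (proj (initialVec ψ K)) = proj (finalVec ψ L)

/-- Non-catalytic exact state merging (`L = 1`) of `ψ` can be achieved by a one-way LOCC map from
`A` to `B` assisted by a resource state of Schmidt rank `K`, i.e. at entanglement cost `log₂ K`. -/
def OneWayNonCatalyticMergeable [DecidableEq R] [DecidableEq A] [DecidableEq B]
    (ψ : EuclideanSpace ℂ (R × A × B)) (K : ℕ) : Prop :=
  ∃ M : Op ((A × Fin K) × (B × Fin K)) →ₗ[ℂ] Op (Fin 1 × ((A × B) × Fin 1)),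
    IsOneWayLOCC M ∧ AchievesMerging ψ K 1 M

/-! ### Majorization and the converse bound -/

/-- The sum of the `k` largest eigenvalues (with multiplicity) of a Hermitian operator; beyond the
dimension, the list of eigenvalues is continued by zeros. -/
def sumLargest {n : Type*} [Fintype n] [DecidableEq n] {X : Op n} (hX : X.IsHermitian) (k : ℕ) :
    ℝ :=
  ∑ i : Fin (Fintype.card n), if (i : ℕ) < k then hX.eigenvalues₀ i else 0

/-- Majorization `X ≺ Y`. The operators may act on spaces of different dimensions: for positive
semidefinite operators, as used below, this is majorization of the lists of eigenvalues padded by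
zeros to the same length. -/
def Majorized {m n : Type*} [Fintype m] [DecidableEq m] [Fintype n] [DecidableEq n]
    (X : Op m) (Y : Op n) : Prop :=
  ∃ (hX : X.IsHermitian) (hY : Y.IsHermitian),
    X.trace = Y.trace ∧ ∀ k : ℕ, sumLargest hX k ≤ sumLargest hY k

/-- The set `{log₂ K : (𝟙_K / K) ⊗ ψ^B ≺ ψ^AB}`, with `K` a positive integer. Its minimum is the
converse bound on the entanglement cost of non-catalytic exact state merging of `ψ`. -/
def converseCosts [DecidableEq A] [DecidableEq B] (ψ : EuclideanSpace ℂ (R × A × B)) : Set ℝ :=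
  {c | ∃ K : ℕ, 0 < K ∧
    Majorized (((K : ℂ)⁻¹ • (1 : Op (Fin K))) ⊗ₖ stateB ψ) (stateAB ψ) ∧ c = Real.logb 2 K}

end ExactMerging

end

namespace ExactMerging

/-! ### Linear maps of operators -/

section Maps

variable {k m n m' n' : Type*} [Fintype m] [DecidableEq m] [Fintype m'] [DecidableEq m']
  [Fintype k] [DecidableEq k]

/-! The state is the totally antisymmetric vector of three qutrits. Everything rests on one fact: an
antisymmetric 3 × 3 matrix is singular (`det_eq_zero_of_antisymm`).

Mixed-unitarity: the Choi operator of the channel vanishes on symmetric vectors, so every unitary of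
positive weight would be antisymmetric, hence singular.

Converse bound: the nonzero spectra of ψ^AB and ψ^B both consist of three copies of 1/3, so K = 1 is
admissible, and log₂ K ≥ 0 always.

Merging with K = 1: an outcome of A has effect Bᴴ B, and each row of B steers R and B into a vector
that is antisymmetric under their exchange (`tensorMap_effect_proj`). The final state is pure, so by
positivity each steered state must be sent by B's channel to a multiple of that state
(`eq_smul_proj`). The channel preserves the marginal on R, which is therefore a multiple of 𝟙. As a
matrix V, the steered vector then satisfies V Vᴴ = c 𝟙 with V singular, so it is zero
(`eq_zero_of_antisymm_of_traceSnd`). Hence every effect of A vanishes, against preservation of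
trace. -/

theorem map_eq_sum_single (Φ : Op m →ₗ[ℂ] Op n) (X : Op m) :
    Φ X = ∑ i, ∑ j, X i j • Φ (Matrix.single i j 1) := by
  conv_lhs => rw [Matrix.matrix_eq_sum_single X]
  simp only [map_sum, ← LinearMap.map_smul, Matrix.smul_single, smul_eq_mul, mul_one]

theorem tensorMap_apply (Φ : Op m →ₗ[ℂ] Op n) (Ψ : Op m' →ₗ[ℂ] Op n') (X : Op (m × m'))
    (i j : n × n') :
    tensorMap Φ Ψ X i j = ∑ p, ∑ p', ∑ q, ∑ q', X (p, p') (q, q') *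
      (Φ (Matrix.single p q 1) i.1 j.1 * Ψ (Matrix.single p' q' 1) i.2 j.2) := by
  simp [tensorMap, Fintype.sum_prod_type, Matrix.sum_apply, Matrix.kroneckerMap_apply]

/-- The block of an operator on `k ⊗ m` with indices `r` and `s` in the first factor. -/
def block (X : Op (k × m)) (r s : k) : Op m := Matrix.of fun i j => X (r, i) (s, j)

theorem tensorMap_id_apply (Φ : Op m →ₗ[ℂ] Op n) (X : Op (k × m)) (i j : k × n) :
    tensorMap LinearMap.id Φ X i j = Φ (block X i.1 j.1) i.2 j.2 := by
  rw [tensorMap_apply, map_eq_sum_single Φ]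
  simp only [LinearMap.id_apply, Matrix.single_apply, Matrix.sum_apply, Matrix.smul_apply,
    smul_eq_mul, block, Matrix.of_apply]
  rw [Finset.sum_eq_single i.1]
  · refine Finset.sum_congr rfl fun p _ => ?_
    rw [Finset.sum_eq_single j.1]
    · simp
    · intro b _ hb
      simp [hb]
    · simp
  · intro b _ hb
    simp [hb]
  · simp

theorem posSemidef_proj (v : n → ℂ) [Finite n] : (proj v).PosSemidef :=
  Matrix.posSemidef_vecMulVec_self_star v

theorem proj_apply (v : n → ℂ) (i j : n) : proj v i j = v i * star (v j) := rfl

/-- A sum of conjugations by operators is completely positive. -/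
theorem isCP_of_kraus {s : Type*} [Fintype s] [Finite n] (Φ : Op m →ₗ[ℂ] Op n)
    (V : s → Matrix n m ℂ) (h : ∀ X, Φ X = ∑ a, V a * X * (V a)ᴴ) : IsCP Φ := by
  intro d X hX
  have key : tensorMap (LinearMap.id : Op (Fin d) →ₗ[ℂ] Op (Fin d)) Φ X =
      ∑ a, ((1 : Op (Fin d)) ⊗ₖ V a) * X * ((1 : Op (Fin d)) ⊗ₖ V a)ᴴ := by
    ext ⟨r, i⟩ ⟨r', j⟩
    rw [tensorMap_id_apply, h]
    simp only [Matrix.sum_apply, Matrix.mul_apply, Fintype.sum_prod_type, block, Matrix.of_apply,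
      Matrix.conjTranspose_apply, Matrix.kroneckerMap_apply, Matrix.one_apply]
    simp [Finset.sum_ite_eq, ite_mul, Finset.sum_mul, apply_ite (starRingEnd ℂ)]
  rw [key]
  exact Matrix.posSemidef_sum _ fun a _ => hX.mul_mul_conjTranspose_same _

/-- A completely positive map into scalars is given by a positive semidefinite matrix. -/
theorem IsCP.posSemidef_of_unique {d : ℕ} {Φ : Op (Fin d × Fin 1) →ₗ[ℂ] Op (Fin 1)}
    (h : IsCP Φ) :
    (Matrix.of fun a b : Fin d × Fin 1 => Φ (Matrix.single a b 1) 0 0).PosSemidef := by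
  -- The unnormalized maximally entangled vector; its image under id ⊗ Φ is the Choi matrix of Φ,
  -- here the matrix to be bounded.
  let Ω : Fin d × (Fin d × Fin 1) → ℂ := fun x => if x.2 = (x.1, 0) then 1 else 0
  have hp := (h d (proj Ω) (posSemidef_proj Ω)).submatrix
    (fun a : Fin d × Fin 1 => (a.1, (0 : Fin 1)))
  convert hp using 1
  ext ⟨a, u⟩ ⟨b, v⟩
  rw [Matrix.submatrix_apply, tensorMap_id_apply, Matrix.of_apply]
  suffices h2 : Matrix.single (a, u) (b, v) 1 = block (proj Ω) a b by rw [h2]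
  obtain rfl := Subsingleton.elim u 0
  obtain rfl := Subsingleton.elim v 0
  ext p q
  by_cases h1 : p = (a, 0) <;> by_cases h2 : q = (b, 0) <;>
    simp [block, proj_apply, Ω, h1, h2, eq_comm (b := p), eq_comm (b := q)]

theorem exists_eq_conjTranspose_mul_self {A : Op m} (h : A.PosSemidef) :
    ∃ B : Op m, A = Bᴴ * B := by
  open scoped MatrixOrder in
  exact CStarAlgebra.nonneg_iff_eq_star_mul_self.mp h.nonneg

/-- Applying the effect `Bᴴ B` on `m` to a pure state leaves a mixture of the pure states with these
vectors. -/
def steered (Ψ : k × m × m' → ℂ) (B : Op m) (s : m) : k × m' → ℂ :=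
  fun x => ∑ a, Ψ (x.1, a, x.2) * star (B s a)

/-- Since A's output is one-dimensional, `E` is determined by its effect; factoring this as Bᴴ B
splits it into rank-one effects, one for each row of `B`. -/
theorem tensorMap_effect_proj (E : Op m →ₗ[ℂ] Op (Fin 1)) (F : Op m' →ₗ[ℂ] Op n') (B : Op m)
    (hB : (Matrix.of fun a b => E (Matrix.single a b 1) 0 0) = Bᴴ * B) (Ψ : k × m × m' → ℂ)
    (r r' : k) (y y' : n') :
    tensorMap LinearMap.id (tensorMap E F) (proj Ψ) (r, 0, y) (r', 0, y') =
      ∑ s, tensorMap LinearMap.id F (proj (steered Ψ B s)) (r, y) (r', y') := by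
  have hE : ∀ a b, E (Matrix.single a b 1) 0 0 = ∑ s, star (B s a) * B s b := fun a b => by
    have := congrFun (congrFun hB a) b
    simpa [Matrix.mul_apply] using this
  rw [tensorMap_id_apply, tensorMap_apply]
  simp only [tensorMap_id_apply, hE]
  have hF : ∀ s, F (block (proj (steered Ψ B s)) r r') y y' = ∑ b, ∑ b', ∑ a, ∑ a',
      Ψ (r, a, b) * star (B s a) * (star (Ψ (r', a', b')) * B s a') *
        F (Matrix.single b b' 1) y y' := by
    intro s
    rw [map_eq_sum_single F]
    simp only [Matrix.sum_apply, Matrix.smul_apply, block, Matrix.of_apply, proj_apply, steered,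
      smul_eq_mul, star_sum, star_mul', star_star, Finset.sum_mul, Finset.mul_sum]
    exact Finset.sum_congr rfl fun _ _ => Finset.sum_congr rfl fun _ _ => Finset.sum_comm
  have hcomm : ∀ g : m → m' → m → m' → ℂ, ∑ a, ∑ b, ∑ a', ∑ b', g a b a' b' =
      ∑ b, ∑ b', ∑ a, ∑ a', g a b a' b' := fun g => by
    rw [Finset.sum_comm]
    refine Finset.sum_congr rfl fun b _ => ?_
    rw [Finset.sum_comm (s := (Finset.univ : Finset m')) (t := (Finset.univ : Finset m))]
    exact Finset.sum_congr rfl fun a _ => Finset.sum_comm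
  simp only [hF]
  rw [hcomm, Finset.sum_comm]
  conv_rhs => rw [Finset.sum_comm]
  rw [Finset.sum_comm]
  refine Finset.sum_congr rfl fun b _ => ?_
  conv_rhs => rw [Finset.sum_comm]
  refine Finset.sum_congr rfl fun b' _ => ?_
  conv_rhs => rw [Finset.sum_comm]
  refine Finset.sum_congr rfl fun a _ => ?_
  conv_rhs => rw [Finset.sum_comm]
  refine Finset.sum_congr rfl fun a' _ => ?_
  simp only [block, Matrix.of_apply, proj_apply, Finset.mul_sum, Finset.sum_mul]
  refine Finset.sum_congr rfl fun s _ => ?_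
  ring

/-- A trace-preserving map of the second factor leaves the reduced state of the first unchanged. -/
theorem traceSnd_tensorMap_id [Fintype n] {Φ : Op m →ₗ[ℂ] Op n}
    (h : ∀ X, (Φ X).trace = X.trace) (X : Op (k × m)) :
    traceSnd (tensorMap LinearMap.id Φ X) = traceSnd X := by
  ext r s
  simp only [traceSnd, Matrix.of_apply, tensorMap_id_apply]
  exact h (block X r s)

/-- A positive semidefinite operator annihilating the orthogonal complement of a unit vector is a
multiple of the projection onto it. -/
theorem eq_smul_proj {T : Op m} (hT : T.PosSemidef) {φ : m → ℂ} (hφ : star φ ⬝ᵥ φ = 1)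
    (h : ∀ ξ, star ξ ⬝ᵥ φ = 0 → star ξ ⬝ᵥ T *ᵥ ξ = 0) : ∃ c : ℂ, T = c • proj φ := by
  have hker : ∀ x, T *ᵥ x = (star φ ⬝ᵥ x) • T *ᵥ φ := fun x => by
    have h0 : star (x - (star φ ⬝ᵥ x) • φ) ⬝ᵥ φ = 0 := by
      rw [star_sub, star_smul, sub_dotProduct, smul_dotProduct, hφ, smul_eq_mul, mul_one,
        Matrix.star_dotProduct, sub_self]
    -- For a positive semidefinite operator, a vanishing quadratic form puts the vector in the
    -- kernel. So `T` kills the complement of φ, and hermiticity then fixes its range.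
    have h1 := (hT.dotProduct_mulVec_zero_iff _).mp (h _ h0)
    rwa [Matrix.mulVec_sub, Matrix.mulVec_smul, sub_eq_zero] at h1
  have hcol : ∀ i j, T i j = (T *ᵥ φ) i * star (φ j) := fun i j => by
    have := congrFun (hker (Pi.single j 1)) i
    simpa [mul_comm] using this
  have hrow : ∀ i, (T *ᵥ φ) i = φ i * star (star φ ⬝ᵥ T *ᵥ φ) := fun i => by
    rw [Matrix.mulVec, dotProduct, dotProduct, star_sum, Finset.mul_sum]
    refine Finset.sum_congr rfl fun j _ => ?_
    rw [← hT.1.apply i j, hcol j i]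
    simp only [star_mul', star_star, Pi.star_apply]
    ring
  refine ⟨star (star φ ⬝ᵥ T *ᵥ φ), ?_⟩
  ext i j
  rw [hcol, hrow, Matrix.smul_apply, proj_apply, smul_eq_mul]
  ring

end Maps
/-! ### The antisymmetric state of three qutrits -/

/-- The Levi-Civita symbol on three indices. -/
def leviCivita (i j k : Fin 3) : ℤ :=
  -- The Vandermonde product is 0 or ±2, so the integer division is exact. Integer values let
  -- `decide` verify the contraction identities.
  ((j : ℤ) - (i : ℤ)) * ((k : ℤ) - (i : ℤ)) * ((k : ℤ) - (j : ℤ)) / 2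

theorem sum_leviCivita_fst (j k j' k' : Fin 3) :
    ∑ i, leviCivita i j k * leviCivita i j' k' =
      (if j = j' ∧ k = k' then 1 else 0) - (if j = k' ∧ k = j' then 1 else 0) := by
  revert j k j' k'
  decide

theorem sum_leviCivita_snd (i k i' k' : Fin 3) :
    ∑ j, leviCivita i j k * leviCivita i' j k' =
      (if i = i' ∧ k = k' then 1 else 0) - (if i = k' ∧ k = i' then 1 else 0) := by
  revert i k i' k'
  decide

/-- Source of the antisymmetry of the steered vectors: the outer indices belong to R and B. -/
theorem leviCivita_swap (i j k : Fin 3) : leviCivita k j i = -leviCivita i j k := by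
  revert i j k
  decide

/-- The totally antisymmetric unit vector of three qutrits. -/
noncomputable def antisym : EuclideanSpace ℂ (Fin 3 × Fin 3 × Fin 3) :=
  WithLp.toLp 2 fun x => ((Real.sqrt 6)⁻¹ : ℝ) * (leviCivita x.1 x.2.1 x.2.2 : ℂ)

theorem antisym_apply (i j k : Fin 3) :
    antisym (i, j, k) = ((Real.sqrt 6)⁻¹ : ℝ) * (leviCivita i j k : ℂ) := rfl

theorem proj_antisym_apply (i j k i' j' k' : Fin 3) :
    proj antisym (i, j, k) (i', j', k') =
      (1 / 6 : ℂ) * ((leviCivita i j k * leviCivita i' j' k' : ℤ) : ℂ) := by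
  have h : (((Real.sqrt 6)⁻¹ : ℝ) : ℂ) * (((Real.sqrt 6)⁻¹ : ℝ) : ℂ) = 1 / 6 := by
    rw [← Complex.ofReal_mul, ← mul_inv, Real.mul_self_sqrt (by norm_num)]
    norm_num
  rw [proj_apply, antisym_apply, antisym_apply, ← h]
  simp only [Complex.star_def, map_mul, Complex.conj_ofReal, map_intCast, Int.cast_mul]
  ring

theorem stateAB_antisym_apply (j k j' k' : Fin 3) :
    stateAB antisym (j, k) (j', k') = (1 / 6 : ℂ) *
      ((if j = j' ∧ k = k' then 1 else 0) - (if j = k' ∧ k = j' then 1 else 0)) := by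
  have := sum_leviCivita_fst j k j' k'
  simp only [stateAB, traceFst, Matrix.of_apply, proj_antisym_apply, ← Finset.mul_sum,
    ← Int.cast_sum, this]
  push_cast
  rfl

theorem stateRB_antisym_apply (i k i' k' : Fin 3) :
    stateRB antisym (i, k) (i', k') = (1 / 6 : ℂ) *
      ((if i = i' ∧ k = k' then 1 else 0) - (if i = k' ∧ k = i' then 1 else 0)) := by
  have := sum_leviCivita_snd i k i' k'
  simp only [stateRB, Matrix.of_apply, proj_antisym_apply, ← Finset.mul_sum,
    ← Int.cast_sum, this]
  push_cast
  rfl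

theorem stateB_antisym : stateB antisym = (1 / 3 : ℂ) • (1 : Op (Fin 3)) := by
  ext k k'
  simp only [stateB, traceFst, Matrix.of_apply, stateAB_antisym_apply, Matrix.smul_apply,
    Matrix.one_apply, ← Finset.mul_sum, smul_eq_mul]
  have h : ∀ k k' : Fin 3, ∑ j : Fin 3, ((if True ∧ k = k' then (1 : ℤ) else 0) -
      (if j = k' ∧ k = j then 1 else 0)) = 2 * (if k = k' then 1 else 0) := by
    decide
  have := congrArg (Int.cast : ℤ → ℂ) (h k k')
  simp only [Int.cast_sum, Int.cast_sub, Int.cast_ite, Int.cast_one, Int.cast_zero, Int.cast_mul,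
    Int.cast_ofNat] at this
  rw [this]
  ring

theorem stateR_antisym : stateR antisym = (1 / 3 : ℂ) • (1 : Op (Fin 3)) := by
  have h : stateR antisym = traceSnd (stateRB antisym) := by
    ext i i'
    simp only [stateR, traceSnd, stateRB, Matrix.of_apply, Fintype.sum_prod_type]
    exact Finset.sum_comm
  rw [h]
  ext i i'
  simp only [traceSnd, Matrix.of_apply, stateRB_antisym_apply, Matrix.smul_apply,
    Matrix.one_apply, ← Finset.mul_sum, smul_eq_mul]
  have h : ∀ i i' : Fin 3, ∑ k : Fin 3, ((if i = i' ∧ True then (1 : ℤ) else 0) -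
      (if i = k ∧ k = i' then 1 else 0)) = 2 * (if i = i' then 1 else 0) := by
    decide
  have := congrArg (Int.cast : ℤ → ℂ) (h i i')
  simp only [Int.cast_sum, Int.cast_sub, Int.cast_ite, Int.cast_one, Int.cast_zero, Int.cast_mul,
    Int.cast_ofNat] at this
  rw [this]
  ring

theorem wernerHolevo_single_apply (i i' k k' : Fin 3) :
    wernerHolevo (Matrix.single i i' 1) k k' = (1 / 2 : ℂ) *
      ((if i = i' ∧ k = k' then 1 else 0) - (if i = k' ∧ k = i' then 1 else 0)) := by
  have ht : (Matrix.single i i' (1 : ℂ)).trace = if i = i' then 1 else 0 := by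
    simp [Matrix.trace, Matrix.single_apply, ite_and, eq_comm]
  simp only [wernerHolevo, LinearMap.coe_mk, AddHom.coe_mk, Matrix.sub_apply, Matrix.smul_apply,
    Matrix.transpose_apply, Matrix.one_apply, smul_eq_mul, ht, Matrix.single_apply, ite_and,
    eq_comm (a := k)]
  split_ifs <;> ring

theorem choi_wernerHolevo_apply (i k i' k' : Fin 3) :
    choi wernerHolevo (i, k) (i', k') = (1 / 2 : ℂ) *
      ((if i = i' ∧ k = k' then 1 else 0) - (if i = k' ∧ k = i' then 1 else 0)) := by
  have h : choi wernerHolevo (i, k) (i', k') = wernerHolevo (Matrix.single i i' 1) k k' := by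
    simp only [choi, Matrix.sum_apply, Matrix.kroneckerMap_apply, Matrix.single_apply]
    rw [Finset.sum_eq_single i, Finset.sum_eq_single i']
    · simp
    · intro b _ hb
      simp [hb]
    · simp
    · intro b _ hb
      simp [hb]
    · simp
  rw [h, wernerHolevo_single_apply]

theorem stateRB_antisym :
    stateRB antisym = (1 / 3 : ℂ) • choi wernerHolevo := by
  ext ⟨i, k⟩ ⟨i', k'⟩
  rw [stateRB_antisym_apply, Matrix.smul_apply, choi_wernerHolevo_apply, smul_eq_mul, ← mul_assoc]
  norm_num

theorem trace_proj_antisym : (stateR antisym).trace = 1 := by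
  rw [stateR_antisym]
  simp

theorem star_antisym_dotProduct :
    star (antisym : Fin 3 × Fin 3 × Fin 3 → ℂ) ⬝ᵥ antisym = 1 := by
  rw [← trace_proj_antisym, Matrix.trace, dotProduct, Fintype.sum_prod_type]
  refine Finset.sum_congr rfl fun i _ => ?_
  rw [Matrix.diag_apply, stateR, traceSnd, Matrix.of_apply]
  refine Finset.sum_congr rfl fun x _ => ?_
  rw [proj_apply, mul_comm]
  rfl

theorem norm_antisym : ‖antisym‖ = 1 := by
  have h := star_antisym_dotProduct
  have h2 : inner ℂ antisym antisym = (1 : ℂ) := by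
    rw [← h, EuclideanSpace.inner_eq_star_dotProduct, dotProduct_comm]
  rw [inner_self_eq_norm_sq_to_K] at h2
  have h3 : ‖antisym‖ ^ 2 = 1 := Complex.ofReal_injective (by simpa using h2)
  exact (pow_eq_one_iff_of_nonneg (norm_nonneg _) two_ne_zero).mp h3

/-! ### The channel -/

theorem isChannel_wernerHolevo : IsChannel wernerHolevo := by
  -- Kraus operators: the slices of the Levi-Civita symbol at a fixed middle index, over √2.
  -- Contracting that index yields identity minus swap.
  refine ⟨isCP_of_kraus wernerHolevo (fun a : Fin 3 => Matrix.of fun k i =>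
    ((Real.sqrt 2)⁻¹ : ℝ) * (leviCivita i a k : ℂ)) fun X => ?_, fun X => ?_⟩
  · have h2 : (((Real.sqrt 2)⁻¹ : ℝ) : ℂ) * (((Real.sqrt 2)⁻¹ : ℝ) : ℂ) = 1 / 2 := by
      rw [← Complex.ofReal_mul, ← mul_inv, Real.mul_self_sqrt (by norm_num)]
      norm_num
    ext k k'
    have key : ∀ i i', ∑ a, (((Real.sqrt 2)⁻¹ : ℝ) * (leviCivita i a k : ℂ)) * X i i' *
        star (((Real.sqrt 2)⁻¹ : ℝ) * (leviCivita i' a k' : ℂ)) = 1 / 2 * X i i' *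
        ((if i = i' ∧ k = k' then 1 else 0) - (if i = k' ∧ k = i' then 1 else 0)) := by
      intro i i'
      have := congrArg (Int.cast : ℤ → ℂ) (sum_leviCivita_snd i k i' k')
      push_cast at this
      rw [← this, ← h2, Finset.mul_sum]
      refine Finset.sum_congr rfl fun a _ => ?_
      simp only [Complex.star_def, map_mul, Complex.conj_ofReal, map_intCast]
      ring
    simp only [Matrix.sum_apply, Matrix.mul_apply, Matrix.of_apply, Matrix.conjTranspose_apply,
      Finset.sum_mul]
    rw [Finset.sum_comm]
    simp only [wernerHolevo, LinearMap.coe_mk, AddHom.coe_mk, Matrix.sub_apply, Matrix.smul_apply,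
      Matrix.transpose_apply, Matrix.one_apply, smul_eq_mul, Matrix.trace, Matrix.diag_apply]
    rw [Finset.sum_congr rfl fun i' _ => Finset.sum_comm]
    simp only [key, mul_sub, Finset.sum_sub_distrib, ite_and, mul_ite, mul_zero, mul_one,
      Finset.sum_ite_eq', Finset.mem_univ, if_true, eq_comm (a := k)]
    split_ifs <;> simp [Finset.mul_sum]
  · simp only [wernerHolevo, LinearMap.coe_mk, AddHom.coe_mk, Matrix.trace_sub, Matrix.trace_smul,
      Matrix.trace_one, Matrix.trace_transpose, smul_eq_mul, Fintype.card_fin]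
    push_cast
    ring

theorem wernerHolevo_one : wernerHolevo 1 = 1 := by
  ext i j
  simp only [wernerHolevo, LinearMap.coe_mk, AddHom.coe_mk, Matrix.sub_apply, Matrix.smul_apply,
    Matrix.transpose_one, Matrix.trace_one, smul_eq_mul, Fintype.card_fin, Matrix.one_apply]
  split_ifs <;> norm_num

/-- Transposition preserves the determinant, while negation multiplies it by (-1)³ in dimension 3.
-/
theorem det_eq_zero_of_antisymm {V : Op (Fin 3)} (h : ∀ i j, V j i = -V i j) : V.det = 0 := by
  have h1 : V.det = -V.det := by
    have : Vᵀ = -V := by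
      ext i j
      simp [h i j]
    conv_lhs => rw [← Matrix.det_transpose, this, Matrix.det_neg]
    norm_num
  exact self_eq_neg.mp h1

theorem not_isMixedUnitary_wernerHolevo : ¬ IsMixedUnitary wernerHolevo := by
  rintro ⟨N, p, U, hp, hp1, h⟩
  have hent : ∀ i i' k k' : Fin 3, wernerHolevo (Matrix.single i i' 1) k k' =
      ∑ m, (p m : ℂ) * ((U m : Op (Fin 3)) k i * star ((U m : Op (Fin 3)) k' i')) := by
    intro i i' k k'
    rw [h]
    simp only [Matrix.sum_apply, Matrix.smul_apply, smul_eq_mul]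
    refine Finset.sum_congr rfl fun m _ => ?_
    rw [Matrix.mul_apply]
    simp only [Matrix.conjTranspose_apply]
    congr 1
    rw [Finset.sum_eq_single i']
    · simp [Matrix.mul_apply, Matrix.single_apply]
    · intro b _ hb
      simp [Matrix.mul_apply, hb.symm]
    · simp
  obtain ⟨m, -, hm⟩ : ∃ m ∈ Finset.univ, p m ≠ 0 := by
    by_contra! hc
    rw [Finset.sum_eq_zero hc] at hp1
    exact zero_ne_one hp1
  have hanti : ∀ i j, (U m : Op (Fin 3)) j i = -(U m : Op (Fin 3)) i j := by
    intro i j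
    have hsum : ∑ m, p m * Complex.normSq ((U m : Op (Fin 3)) i j + (U m : Op (Fin 3)) j i) = 0 := by
      -- The expectation of the Choi operator in the symmetric vector |ij⟩ + |ji⟩, which is zero; in
      -- the mixed-unitary form it is the weighted sum of |Uᵢⱼ + Uⱼᵢ|².
      have h0 : wernerHolevo (Matrix.single i i 1) j j + wernerHolevo (Matrix.single j j 1) i i +
          wernerHolevo (Matrix.single i j 1) j i + wernerHolevo (Matrix.single j i 1) i j = 0 := by
        simp only [wernerHolevo_single_apply]
        by_cases hij : i = j
        · subst hij
          norm_num
        · simp only [hij, Ne.symm hij, and_self, if_true, if_false]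
          norm_num
      rw [hent, hent, hent, hent, ← Finset.sum_add_distrib, ← Finset.sum_add_distrib,
        ← Finset.sum_add_distrib] at h0
      have : ((∑ m, p m * Complex.normSq ((U m : Op (Fin 3)) i j + (U m : Op (Fin 3)) j i) : ℝ) : ℂ)
          = 0 := by
        rw [← h0]
        push_cast
        refine Finset.sum_congr rfl fun m _ => ?_
        rw [Complex.normSq_eq_conj_mul_self]
        simp only [Complex.star_def, map_add]
        ring
      exact_mod_cast this
    have := (Finset.sum_eq_zero_iff_of_nonneg fun m _ =>
      mul_nonneg (hp m) (Complex.normSq_nonneg _)).mp hsum m (Finset.mem_univ m)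
    have := Complex.normSq_eq_zero.mp ((mul_eq_zero.mp this).resolve_left hm)
    linear_combination this
  have hU : IsUnit (U m : Op (Fin 3)).det :=
    (Matrix.isUnit_iff_isUnit_det _).mp (Unitary.toUnits (U m)).isUnit
  rw [det_eq_zero_of_antisymm hanti] at hU
  exact not_isUnit_zero hU

/-! ### The converse bound -/

/-- An eigenvalue satisfies λ² = cλ. With c = 1/3 and the trace, this determines both spectra in the
majorization. -/
theorem eigenvalues₀_of_mul_self_eq {n : Type*} [Fintype n] [DecidableEq n] {Y : Op n}
    (hY : Y.IsHermitian) {c : ℝ} (h : Y * Y = (c : ℂ) • Y) (i : Fin (Fintype.card n)) :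
    hY.eigenvalues₀ i = 0 ∨ hY.eigenvalues₀ i = c := by
  let j : n := Fintype.equivOfCardEq (Fintype.card_fin _) i
  have hj : hY.eigenvalues j = hY.eigenvalues₀ i := by simp [Matrix.IsHermitian.eigenvalues, j]
  rw [← hj]
  obtain ⟨v, hvdef⟩ : ∃ v, v = (hY.eigenvectorBasis j).ofLp := ⟨_, rfl⟩
  have hv := hY.mulVec_eigenvectorBasis j
  rw [← hvdef] at hv
  have h2 : (Y * Y) *ᵥ v = ((hY.eigenvalues j : ℂ) * hY.eigenvalues j) • v := by
    rw [← Matrix.mulVec_mulVec, hv, Matrix.mulVec_smul, hv]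
    ext
    simp [mul_assoc]
  have h3 : (Y * Y) *ᵥ v = ((c : ℂ) * hY.eigenvalues j) • v := by
    rw [h, Matrix.smul_mulVec, hv]
    ext
    simp [mul_assoc]
  have hne : v ≠ 0 := fun h0 => hY.eigenvectorBasis.orthonormal.ne_zero j (by
    ext x
    exact congrFun (hvdef.symm.trans h0) x)
  have h4 := smul_left_injective ℂ hne (h2.symm.trans h3)
  have h5 : hY.eigenvalues j * hY.eigenvalues j = c * hY.eigenvalues j := by exact_mod_cast h4
  rcases eq_or_ne (hY.eigenvalues j) 0 with h0 | h0
  · exact Or.inl h0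
  · exact Or.inr (mul_right_cancel₀ h0 h5)

theorem sum_eigenvalues₀ {n : Type*} [Fintype n] [DecidableEq n] {Y : Op n}
    (hY : Y.IsHermitian) : ((∑ i, hY.eigenvalues₀ i : ℝ) : ℂ) = Y.trace := by
  rw [hY.trace_eq_sum_eigenvalues]
  push_cast
  exact ((Fintype.equivOfCardEq (Fintype.card_fin _)).symm.sum_comp
    fun i => (hY.eigenvalues₀ i : ℂ)).symm

theorem stateAB_antisym_mul_self :
    stateAB antisym * stateAB antisym = ((1 / 3 : ℝ) : ℂ) • stateAB antisym := by
  ext ⟨j, k⟩ ⟨j', k'⟩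
  rw [Matrix.mul_apply, Fintype.sum_prod_type]
  simp only [Matrix.smul_apply, stateAB_antisym_apply, smul_eq_mul]
  have h : ∀ x y, (1 / 6 : ℂ) * ((if j = x ∧ k = y then 1 else 0) - (if j = y ∧ k = x then 1 else 0))
      * (1 / 6 * ((if x = j' ∧ y = k' then 1 else 0) - (if x = k' ∧ y = j' then 1 else 0))) =
      ((((if j = x ∧ k = y then 1 else 0) - (if j = y ∧ k = x then 1 else 0)) *
      ((if x = j' ∧ y = k' then 1 else 0) - (if x = k' ∧ y = j' then 1 else 0)) : ℤ) : ℂ) / 36 := by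
    intro x y
    push_cast
    ring
  have hint : ∀ j k j' k' : Fin 3, ∑ x : Fin 3, ∑ y : Fin 3,
      (((if j = x ∧ k = y then 1 else 0) - (if j = y ∧ k = x then 1 else 0)) *
      ((if x = j' ∧ y = k' then 1 else 0) - (if x = k' ∧ y = j' then 1 else 0)) : ℤ) =
      2 * ((if j = j' ∧ k = k' then 1 else 0) - (if j = k' ∧ k = j' then 1 else 0)) := by
    decide
  simp only [h, ← Finset.sum_div, ← Int.cast_sum, hint]
  push_cast
  ring

theorem majorized_antisym :
    Majorized ((((1 : ℕ) : ℂ)⁻¹ • (1 : Op (Fin 1))) ⊗ₖ stateB antisym) (stateAB antisym) := by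
  have hXeq : (((1 : ℕ) : ℂ)⁻¹ • (1 : Op (Fin 1))) ⊗ₖ stateB antisym =
      ((1 / 3 : ℝ) : ℂ) • (1 : Op (Fin 1 × Fin 3)) := by
    rw [stateB_antisym, Matrix.kronecker_smul]
    simp
  rw [hXeq]
  have hX : (((1 / 3 : ℝ) : ℂ) • (1 : Op (Fin 1 × Fin 3))).IsHermitian := by
    rw [Matrix.IsHermitian, Matrix.conjTranspose_smul, Matrix.conjTranspose_one]
    simp
  have hY : (stateAB antisym).IsHermitian := by
    ext ⟨j, k⟩ ⟨j', k'⟩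
    rw [Matrix.conjTranspose_apply, stateAB_antisym_apply, stateAB_antisym_apply]
    fin_cases j <;> fin_cases k <;> fin_cases j' <;> fin_cases k' <;> simp
  have htX : (((1 / 3 : ℝ) : ℂ) • (1 : Op (Fin 1 × Fin 3))).trace = 1 := by
    simp
  have htY : (stateAB antisym).trace = 1 := by
    have : (stateAB antisym).trace = (stateB antisym).trace := by
      simp only [Matrix.trace, stateB, traceFst, Matrix.diag_apply, Matrix.of_apply,
        Fintype.sum_prod_type]
      exact Finset.sum_comm
    rw [this, stateB_antisym]
    simp
  refine ⟨hX, hY, htX.trans htY.symm, fun k => ?_⟩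
  have hx := eigenvalues₀_of_mul_self_eq hX (c := 1 / 3) (by
    rw [Matrix.smul_mul, Matrix.one_mul])
  have hy := eigenvalues₀_of_mul_self_eq hY stateAB_antisym_mul_self
  have hxs : ∑ i, hX.eigenvalues₀ i = 1 := by exact_mod_cast (sum_eigenvalues₀ hX).trans htX
  have hys : ∑ i, hY.eigenvalues₀ i = 1 := by exact_mod_cast (sum_eigenvalues₀ hY).trans htY
  have hy3 : ∀ i : Fin (Fintype.card (Fin 3 × Fin 3)), (i : ℕ) < 3 →
      hY.eigenvalues₀ i = 1 / 3 := by
    intro i hi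
    refine (hy i).resolve_left fun h0 => ?_
    -- The eigenvalues are in decreasing order, so a zero among the first three leaves at most two
    -- nonzero ones, and the total is at most 2/3 instead of 1.
    have hle : ∑ j, hY.eigenvalues₀ j ≤
        ∑ j : Fin (Fintype.card (Fin 3 × Fin 3)), if (j : ℕ) < 2 then (1 / 3 : ℝ) else 0 := by
      refine Finset.sum_le_sum fun j _ => ?_
      split_ifs with hj
      · rcases hy j with h | h <;> rw [h]
        norm_num
      · exact h0 ▸ hY.eigenvalues₀_antitone (Fin.le_def.mpr (by omega))
    rw [hys, Fin.sum_univ_eq_sum_range (fun j => if j < 2 then (1 / 3 : ℝ) else 0)] at hle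
    norm_num [Fintype.card_prod, Finset.sum_range_succ] at hle
  have hnn : ∀ i, 0 ≤ hY.eigenvalues₀ i := fun i => by
    rcases hy i with h | h <;> rw [h]
    norm_num
  have hcard : Fintype.card (Fin 1 × Fin 3) ≤ Fintype.card (Fin 3 × Fin 3) := by simp
  rw [sumLargest, sumLargest]
  -- The three indices of ψ^B are embedded as the first three of the nine of ψ^AB; the remaining
  -- terms are nonnegative.
  calc _ ≤ ∑ i : Fin (Fintype.card (Fin 1 × Fin 3)),
        if ((Fin.castLE hcard i : Fin _) : ℕ) < k then hY.eigenvalues₀ (Fin.castLE hcard i) else 0 := by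
        refine Finset.sum_le_sum fun i _ => ?_
        have hi : (i : ℕ) < 3 := lt_of_lt_of_eq i.2 (by simp)
        rw [hy3 (Fin.castLE hcard i) hi, Fin.val_castLE]
        split_ifs
        · rcases hx i with h | h <;> rw [h]
          norm_num
        · rfl
    _ = ∑ j ∈ Finset.univ.map (Fin.castLEEmb hcard),
        if (j : ℕ) < k then hY.eigenvalues₀ j else 0 := by
        rw [Finset.sum_map]
        rfl
    _ ≤ _ := Finset.sum_le_sum_of_subset_of_nonneg (Finset.subset_univ _) fun j _ _ => by
        split_ifs
        exacts [hnn j, le_rfl]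

theorem isLeast_converseCosts_antisym : IsLeast (converseCosts antisym) 0 := by
  refine ⟨⟨1, one_pos, majorized_antisym, by simp⟩, ?_⟩
  rintro c ⟨K, hK, -, rfl⟩
  exact Real.logb_nonneg one_lt_two (by exact_mod_cast hK)

/-! ### No one-way merging without entanglement -/

theorem maxEnt_one (l : Fin 1 × Fin 1) : maxEnt 1 l = 1 := by
  simp [maxEnt, Subsingleton.elim l.1 l.2]

/-- An antisymmetric bipartite vector of two qutrits whose first reduced state is a multiple of the
identity vanishes. -/
theorem eq_zero_of_antisymm_of_traceSnd {v : Fin 3 × (Fin 3 × Fin 1) → ℂ}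
    (h : ∀ i j, v (j, i, 0) = -v (i, j, 0)) {c : ℂ} (hc : traceSnd (proj v) = c • 1) : v = 0 := by
  let V : Op (Fin 3) := Matrix.of fun i j => v (i, j, 0)
  have hV : V * Vᴴ = c • 1 := by
    rw [← hc]
    ext i j
    simp [traceSnd, Matrix.mul_apply, V, proj_apply, Fintype.sum_prod_type]
  -- Determinants give c³ = 0, and then V Vᴴ = 0 forces V = 0.
  have hdet := congrArg Matrix.det hV
  rw [Matrix.det_mul, det_eq_zero_of_antisymm (V := V) h, zero_mul, Matrix.det_smul,
    Matrix.det_one, mul_one] at hdet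
  have hc0 : c = 0 := pow_eq_zero_iff (by simp) |>.mp hdet.symm
  rw [hc0, zero_smul, Matrix.self_mul_conjTranspose_eq_zero] at hV
  ext ⟨i, j, u⟩
  obtain rfl := Subsingleton.elim u 0
  exact congrFun (congrFun hV i) j

theorem steered_antisym (B : Op (Fin 3 × Fin 1)) (s : Fin 3 × Fin 1) (i k : Fin 3) :
    steered (initialVec antisym 1) B s (i, k, 0) =
      ∑ a, antisym (i, a, k) * star (B s (a, 0)) := by
  simp [steered, initialVec, maxEnt_one, Fintype.sum_prod_type]

/-- Contraction with the Levi-Civita symbol identifies ℂ³ with the antisymmetric matrices, so no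
nonzero row of `B` steers to zero; the three entries above the diagonal recover its coordinates. -/
theorem eq_zero_of_steered_antisym {B : Op (Fin 3 × Fin 1)}
    (h : ∀ s, steered (initialVec antisym 1) B s = 0) : B = 0 := by
  ext s ⟨a, u⟩
  obtain rfl := Subsingleton.elim u 0
  have hs : ∀ i k, ∑ a, antisym (i, a, k) * star (B s (a, 0)) = 0 := fun i k => by
    rw [← steered_antisym, h]
    rfl
  have h6 : (((Real.sqrt 6)⁻¹ : ℝ) : ℂ) ≠ 0 := by
    simp
  have hz : ∀ i k, ∑ a, (leviCivita i a k : ℂ) * star (B s (a, 0)) = 0 := fun i k => by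
    have := hs i k
    simp only [antisym_apply, mul_assoc, ← Finset.mul_sum] at this
    exact (mul_eq_zero.mp this).resolve_left h6
  have h1 := hz 1 2
  have h2 := hz 0 2
  have h3 := hz 0 1
  simp [Fin.sum_univ_three, leviCivita] at h1 h2 h3
  fin_cases a <;> simpa

theorem not_oneWayNonCatalyticMergeable_antisym : ¬ OneWayNonCatalyticMergeable antisym 1 := by
  rintro ⟨M, ⟨ι, -, E, F, ⟨hE, hEtr⟩, hF, hM⟩, hach⟩
  choose B hB using fun i => exists_eq_conjTranspose_mul_self (hE i).posSemidef_of_unique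
  let φ : Fin 3 × ((Fin 3 × Fin 3) × Fin 1) → ℂ := fun x => finalVec antisym 1 (x.1, 0, x.2)
  let T : ι → Fin 3 × Fin 1 → Op (Fin 3 × ((Fin 3 × Fin 3) × Fin 1)) := fun i s =>
    tensorMap LinearMap.id (F i) (proj (steered (initialVec antisym 1) (B i) s))
  have hT : ∀ i s, (T i s).PosSemidef := fun i s => (hF i).1 3 _ (posSemidef_proj _)
  have hφapp : ∀ r a b, φ (r, (a, b), 0) = antisym (r, a, b) := fun r a b => by
    simp [φ, finalVec, maxEnt_one]
  have hφ : star φ ⬝ᵥ φ = 1 := by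
    rw [← star_antisym_dotProduct]
    simp [dotProduct, Fintype.sum_prod_type, hφapp]
  have htr : traceSnd (proj φ) = (1 / 3 : ℂ) • (1 : Op (Fin 3)) := by
    rw [← stateR_antisym]
    ext r r'
    simp [stateR, traceSnd, Fintype.sum_prod_type, hφapp, proj_apply]
  -- Convergence entry by entry suffices, since only quadratic forms of the sum are used.
  have hsum : ∀ x y, HasSum (fun i => (∑ s, T i s) x y) (proj φ x y) := by
    rintro ⟨r, x⟩ ⟨r', y⟩
    have h1 := hM (block (proj (initialVec antisym 1)) r r')
    have h2 : HasSum (fun i => tensorMap (E i) (F i) (block (proj (initialVec antisym 1)) r r')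
        (0, x) (0, y)) (M (block (proj (initialVec antisym 1)) r r') (0, x) (0, y)) :=
      Pi.hasSum.mp (Pi.hasSum.mp h1 (0, x)) (0, y)
    have h3 : M (block (proj (initialVec antisym 1)) r r') (0, x) (0, y) =
        proj φ (r, x) (r', y) := by
      have := congrFun (congrFun hach (r, 0, x)) (r', 0, y)
      rwa [tensorMap_id_apply] at this
    rw [h3] at h2
    convert h2 using 2 with i
    rw [Matrix.sum_apply, ← tensorMap_effect_proj (E i) (F i) (B i) (hB i), tensorMap_id_apply]
  -- On a vector orthogonal to φ, nonnegative terms sum to zero, so each outcome and each row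
  -- contributes zero.
  have hzero : ∀ ξ, star ξ ⬝ᵥ φ = 0 → ∀ i s, star ξ ⬝ᵥ T i s *ᵥ ξ = 0 := by
    intro ξ hξ i s
    have h1 : HasSum (fun i => star ξ ⬝ᵥ (∑ s, T i s) *ᵥ ξ) (star ξ ⬝ᵥ proj φ *ᵥ ξ) := by
      simp only [dotProduct, Matrix.mulVec]
      exact hasSum_sum fun x _ => (hasSum_sum fun y _ => (hsum x y).mul_right _).mul_left _
    have h2 : star ξ ⬝ᵥ proj φ *ᵥ ξ = 0 := by
      rw [proj, Matrix.vecMulVec_mulVec, dotProduct_smul, hξ, smul_zero]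
    rw [h2, hasSum_zero_iff_of_nonneg fun i =>
      (Matrix.posSemidef_sum _ fun s _ => hT i s).dotProduct_mulVec_nonneg ξ] at h1
    have h3 := congrFun h1 i
    rw [Matrix.sum_mulVec, dotProduct_sum, Pi.zero_apply, Finset.sum_eq_zero_iff_of_nonneg
      fun s _ => (hT i s).dotProduct_mulVec_nonneg ξ] at h3
    exact h3 s (Finset.mem_univ s)
  have hB0 : ∀ i, B i = 0 := fun i => eq_zero_of_steered_antisym fun s => by
    obtain ⟨c, hc⟩ := eq_smul_proj (hT i s) hφ fun ξ hξ => hzero ξ hξ i s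
    refine eq_zero_of_antisymm_of_traceSnd (c := c * (1 / 3)) (fun j k => ?_) ?_
    · rw [steered_antisym, steered_antisym, ← Finset.sum_neg_distrib]
      refine Finset.sum_congr rfl fun a _ => ?_
      rw [antisym_apply, antisym_apply, leviCivita_swap j a k]
      push_cast
      ring
    -- B's channel cannot alter the marginal on R, so the steered vector inherits that of c φ,
    -- namely (c/3) 𝟙.
    · rw [← traceSnd_tensorMap_id (hF i).2, mul_smul, ← htr]
      change traceSnd (T i s) = _
      rw [hc]
      ext r r'
      simp [traceSnd, Finset.mul_sum]
  have hE0 : ∀ i X, (E i X).trace = 0 := fun i X => by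
    have h0 : ∀ a b, E i (Matrix.single a b 1) 0 0 = 0 := fun a b => by
      have := congrFun (congrFun (hB i) a) b
      simpa [hB0 i] using this
    rw [map_eq_sum_single]
    simp [Matrix.trace, Matrix.sum_apply, h0]
  -- At the identity the instrument's traces must sum to 3, but every term is 0.
  have h1 := hEtr 1
  simp only [hE0] at h1
  have := h1.unique hasSum_zero
  simp at this

end ExactMerging

theorem mainTheorem10 :
    -- the channel is a unital channel which is not mixed-unitary
    ExactMerging.IsChannel ExactMerging.wernerHolevo ∧
    ExactMerging.wernerHolevo 1 = 1 ∧
    ¬ ExactMerging.IsMixedUnitary ExactMerging.wernerHolevo ∧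
    ∃ ψ : EuclideanSpace ℂ (Fin 3 × Fin 3 × Fin 3),
      ‖ψ‖ = 1 ∧
      ExactMerging.stateR ψ = (1 / 3 : ℂ) • (1 : ExactMerging.Op (Fin 3)) ∧
      -- the state is a purification of the normalized Choi operator of the channel
      ExactMerging.stateRB ψ = (1 / 3 : ℂ) • ExactMerging.choi ExactMerging.wernerHolevo ∧
      -- the converse bound, a minimum, equals zero
      IsLeast (ExactMerging.converseCosts ψ) 0 ∧
      -- no one-way LOCC algorithm has entanglement cost zero
      ∀ K : ℕ, 0 < K → Real.logb 2 K = 0 → ¬ ExactMerging.OneWayNonCatalyticMergeable ψ K := by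
  open ExactMerging in
  refine ⟨isChannel_wernerHolevo, wernerHolevo_one, not_isMixedUnitary_wernerHolevo, antisym,
    norm_antisym, stateR_antisym, stateRB_antisym, isLeast_converseCosts_antisym,
    fun K hK hlog => ?_⟩
  obtain rfl : K = 1 := by
    by_contra hne
    have hK1 : (1 : ℝ) < K := by exact_mod_cast (by omega : 1 < K)
    exact (Real.logb_pos one_lt_two hK1).ne' hlog
  exact not_oneWayNonCatalyticMergeable_antisym
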